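/- Let $B$ be a (possibly nonunital) $C^*$-algebra and regard $B$ as a subalgebra of its bidual $B^{**}$ (a von Neumann algebra with the Arens product, with identity $1$). Let $p$ be an open projection in $B^{**}$, that is, a projection which is the weak* limit of an increasing net of positive elements of $B$, and let $q=p^\perp=1-p$. Expressions such as $(1-e)x(1-e)$ with $e,x\in B$ stand for the element $x-ex-xe+exe$ of $B$, and $\frac12\mathfrak F_B=\{e\in B:\|1-2e\|\le 1\}$, the norm being that of the unitization of $B$. (1) Let $D$ be the hereditary $C^*$-subalgebra of $B$ with support projection $p$ (that is, $p$ is the identity of the weak* closure of $D$ in $B^{**}$), and let $(f_t)$ be an increasing contractive approximate identity for $D$. If $x\in B$ and $qxq=0$, then $(1-f_t)x(1-f_t)\to 0$ in norm. Moreover, with $I=\{b\in B: qbq=0\}$, for every $x\in B$ $$d(x,I)=\lim_t\|(1-f_t)x(1-f_t)\|=\|qxq\|.$$ (2) Let $(e_t)$ be a net in $\frac12\mathfrak F_B$ with $\mathrm{Re}\,e_s\le \mathrm{Re}\,e_t$ whenever $s\le t$, and with $e_t\to p$ weak* in $B^{**}$. If $x\in B$ and $qxq=0$, then $(1-e_t)x(1-e_t)\to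 0$ in norm. Moreover, if $A$ is a norm-closed Jordan subalgebra of $B$ (a closed subspace with $a^2\in A$ for all $a\in A$) containing all the $e_t$, and $I_A=\{a\in A: qaq=0\}$, then for every $x\in A$ $$d(x,I_A)=\lim_t\|(1-e_t)x(1-e_t)\|=\|qxq\|.$$ In particular this holds with $A=B$. -/

import Mathlib

open Filter Topology

universe u v w

/-- The Banach space bidual `B**`. -/
abbrev Bidual (B : Type*) [NonUnitalCStarAlgebra B] : Type _ :=
  StrongDual ℂ (StrongDual ℂ B)

namespace Bidual

section Basic

variable {B : Type*} [NonUnitalCStarAlgebra B]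

/-- The canonical embedding of `B` in `B**`. -/
noncomputable def ι (b : B) : Bidual B := NormedSpace.inclusionInDoubleDual ℂ B b

/-- The Arens product on `B**`: `(m □ n)(φ) = m (n · φ)`, where `(n · φ)(a) = n (φ · a)` and
`(φ · a)(b) = φ (a b)`. (A C⋆-algebra is Arens regular, so there is only one Arens product.) -/
noncomputable def arens (m n : Bidual B) : Bidual B :=
  m ∘L ((ContinuousLinearMap.compL ℂ B (StrongDual ℂ B) ℂ n) ∘L
    ((ContinuousLinearMap.compL ℂ B (B →L[ℂ] B) (StrongDual ℂ B)).flip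
        (ContinuousLinearMap.mul ℂ B) ∘L
      (ContinuousLinearMap.compL ℂ B B ℂ)))

theorem arens_apply (m n : Bidual B) (φ : StrongDual ℂ B) :
    arens m n φ =
      m (n ∘L (ContinuousLinearMap.compL ℂ B B ℂ φ ∘L ContinuousLinearMap.mul ℂ B)) :=
  rfl

theorem arens_ι_ι (a b : B) : arens (ι a) (ι b) = ι (a * b) := rfl

/-- The adjoint `φ*` of a functional: `φ*(b)` is the complex conjugate of `φ(b*)`. -/
noncomputable def dualStar (φ : StrongDual ℂ B) : StrongDual ℂ B :=
  ((starL ℂ : ℂ ≃L⋆[ℂ] ℂ) : ℂ →L⋆[ℂ] ℂ).comp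
    (φ.comp ((starL ℂ : B ≃L⋆[ℂ] B) : B →L⋆[ℂ] B))

theorem dualStar_apply (φ : StrongDual ℂ B) (b : B) : dualStar φ b = star (φ (star b)) := rfl

/-- `p` is a projection in `B**`: `p² = p` and `p* = p`, where `p*(φ)` is the complex conjugate
of `p(φ*)`. -/
def IsProjection (p : Bidual B) : Prop :=
  arens p p = p ∧ ∀ φ : StrongDual ℂ B, star (p (dualStar φ)) = p φ

/-- `e` is a two-sided identity of `B**`. -/
def IsIdentity (e : Bidual B) : Prop :=
  ∀ η : Bidual B, arens e η = η ∧ arens η e = η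

end Basic

section Order

theorem norm_sq_mix_le {A : Type*} [CStarAlgebra A] [PartialOrder A] [StarOrderedRing A]
    {e a b : A} (h0 : 0 ≤ e) (h1 : e ≤ 1) {s : ℝ} (ha : ‖a‖ ≤ 1) (hb : ‖b‖ ≤ s) :
    ‖e * a + (1 - e) * b‖ ^ 2 ≤ 1 + s ^ 2 := by
  have hs : 0 ≤ s := (norm_nonneg b).trans hb
  have he : star e = e := h0.isSelfAdjoint.star_eq
  have h1e : 0 ≤ 1 - e := sub_nonneg.2 h1
  have hn1 : ‖e‖ ≤ 1 := (CStarAlgebra.norm_le_one_iff_of_nonneg e h0).2 h1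
  have hn2 : ‖1 - e‖ ≤ 1 :=
    (CStarAlgebra.norm_le_one_iff_of_nonneg (1 - e) h1e).2 (by simpa using h0)
  have hpos : 0 ≤ e * (1 - e) := by
    have hc : Commute e (1 - e) := (Commute.one_right e).sub_right (Commute.refl e)
    exact hc.mul_nonneg h0 h1e
  have hkey : star (e * a + (1 - e) * b) * (e * a + (1 - e) * b)
      ≤ star a * e * a + star b * (1 - e) * b := by
    have h := star_left_conjugate_nonneg hpos (a - b)
    rw [← sub_nonneg]
    convert h using 1
    simp only [star_add, star_mul, star_sub, star_one, he]
    noncomm_ring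
  calc ‖e * a + (1 - e) * b‖ ^ 2
      = ‖star (e * a + (1 - e) * b) * (e * a + (1 - e) * b)‖ := by
        rw [CStarRing.norm_star_mul_self, sq]
    _ ≤ ‖star a * e * a + star b * (1 - e) * b‖ :=
        CStarAlgebra.norm_le_norm_of_nonneg_of_le (star_mul_self_nonneg _) hkey
    _ ≤ ‖star a * e * a‖ + ‖star b * (1 - e) * b‖ := norm_add_le _ _
    _ ≤ 1 * 1 * 1 + s * 1 * s := by
        refine add_le_add ?_ ?_
        · refine (norm_mul₃_le).trans ?_
          rw [norm_star]; gcongr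
        · refine (norm_mul₃_le).trans ?_
          rw [norm_star]; gcongr
    _ = 1 + s ^ 2 := by ring

variable (B : Type*) [NonUnitalCStarAlgebra B] [PartialOrder B] [StarOrderedRing B]

theorem norm_sq_mix_le' {e a b : B} (h0 : 0 ≤ e) (h1 : ‖e‖ ≤ 1) {s : ℝ} (ha : ‖a‖ ≤ 1)
    (hb : ‖b‖ ≤ s) : ‖e * a + (b - e * b)‖ ^ 2 ≤ 1 + s ^ 2 := by
  have h0' : (0 : Unitization ℂ B) ≤ (e : Unitization ℂ B) := Unitization.inr_nonneg_iff.2 h0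
  have h := norm_sq_mix_le (e := (e : Unitization ℂ B)) (a := (a : Unitization ℂ B))
    (b := (b : Unitization ℂ B)) (s := s) h0'
    ((CStarAlgebra.norm_le_one_iff_of_nonneg _ h0').1 (by rwa [Unitization.norm_inr]))
    (by rwa [Unitization.norm_inr]) (by rwa [Unitization.norm_inr])
  have heq : (e : Unitization ℂ B) * a + (1 - (e : Unitization ℂ B)) * b
      = ((e * a + (b - e * b) : B) : Unitization ℂ B) := by
    rw [sub_mul, one_mul, Unitization.inr_add, Unitization.inr_sub, Unitization.inr_mul,
      Unitization.inr_mul]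
  rwa [heq, Unitization.norm_inr] at h

variable {B}

/-- Functionals on a C⋆-algebra are approximated in norm by their translates under an approximate
unit. -/
theorem eventually_norm_translate_le (φ : StrongDual ℂ B) {δ : ℝ} (hδ : 0 < δ) :
    ∀ᶠ e in CStarAlgebra.approximateUnit B,
      ‖φ - φ ∘L ContinuousLinearMap.mul ℂ B e‖ ≤ δ := by
  set s : ℝ := δ / (2 + ‖φ‖) with hs
  have hden : 0 < 2 + ‖φ‖ := by positivity
  have hs0 : 0 < s := by positivity
  have hsδ : s * (2 + ‖φ‖) = δ := by rw [hs]; field_simp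
  obtain ⟨a, ha1, ha⟩ : ∃ a : B, ‖a‖ < 1 ∧ ‖φ‖ - s ^ 2 < ‖φ a‖ :=
    φ.exists_lt_apply_of_lt_opNorm (sub_lt_self _ (by positivity))
  have hU := CStarAlgebra.increasingApproximateUnit B
  have hlim : Tendsto (fun e : B => ‖φ (e * a)‖) (CStarAlgebra.approximateUnit B) (𝓝 ‖φ a‖) :=
    ((φ.continuous.tendsto a).comp (hU.tendsto_mul_right a)).norm
  filter_upwards [hlim.eventually (lt_mem_nhds (sub_lt_self ‖φ a‖ (by positivity : 0 < s ^ 2))),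
    hU.eventually_nonneg, hU.eventually_norm] with e he he0 he1
  refine ContinuousLinearMap.opNorm_le_of_unit_norm hδ.le fun b hb => ?_
  change ‖φ b - φ (e * b)‖ ≤ δ
  rw [← map_sub]
  -- align the phases of the two summands
  obtain ⟨u, hu1, hu⟩ : ∃ u : ℂ, ‖u‖ ≤ 1 ∧
      ‖φ (e * a)‖ + s * ‖φ (b - e * b)‖ ≤ ‖φ (e * a) + (s * u) * φ (b - e * b)‖ := by
    set z := φ (e * a)
    set w := φ (b - e * b)
    by_cases hz : z = 0
    · refine ⟨1, by simp, ?_⟩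
      simp [hz, abs_of_pos hs0]
    by_cases hw : w = 0
    · exact ⟨0, by simp, by simp [hw]⟩
    have hz' : (‖z‖ : ℂ) ≠ 0 := by simpa using hz
    have hw' : (‖w‖ : ℂ) ≠ 0 := by simpa using hw
    refine ⟨(z / ‖z‖) * (‖w‖ / w), ?_, ?_⟩
    · simp [hz, hw]
    · have : z + s * (z / ‖z‖ * (‖w‖ / w)) * w
          = (z / ‖z‖) * ((‖z‖ + s * ‖w‖ : ℝ) : ℂ) := by
        push_cast
        field_simp
      rw [this, norm_mul, Complex.norm_real, Real.norm_of_nonneg (by positivity)]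
      simp [hz]
  have hmix := norm_sq_mix_le' B he0 he1 ha1.le (b := ((s : ℂ) * u) • b) (s := s) (by
    rw [norm_smul, hb, mul_one, norm_mul, Complex.norm_real, Real.norm_of_nonneg hs0.le]
    exact mul_le_of_le_one_right hs0.le hu1)
  have hnorm : ‖e * a + (((s : ℂ) * u) • b - e * (((s : ℂ) * u) • b))‖ ≤ 1 + s ^ 2 := by
    nlinarith [norm_nonneg (e * a + (((s : ℂ) * u) • b - e * (((s : ℂ) * u) • b))), sq_nonneg s]
  have happ := φ.le_opNorm (e * a + (((s : ℂ) * u) • b - e * (((s : ℂ) * u) • b)))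
  have heq : φ (e * a + (((s : ℂ) * u) • b - e * (((s : ℂ) * u) • b)))
      = φ (e * a) + (s * u) * φ (b - e * b) := by
    rw [map_add, mul_smul_comm, ← smul_sub, map_smul, smul_eq_mul]
  rw [heq] at happ
  have hfin : s * ‖φ (b - e * b)‖ ≤ s * δ := by
    have h3 : ‖φ‖ * ‖e * a + (((s : ℂ) * u) • b - e * (((s : ℂ) * u) • b))‖
        ≤ ‖φ‖ * (1 + s ^ 2) := by gcongr
    calc s * ‖φ (b - e * b)‖ ≤ ‖φ‖ * (1 + s ^ 2) - ‖φ (e * a)‖ := by linarith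
      _ ≤ s * (s * (2 + ‖φ‖)) := by nlinarith
      _ = s * δ := by rw [hsδ]
  exact le_of_mul_le_mul_left hfin hs0

variable (B) in
/-- The bidual of a C⋆-algebra, with the Arens product, has an identity. -/
theorem exists_isIdentity : ∃ e : Bidual B, IsIdentity e := by
  have hU := CStarAlgebra.increasingApproximateUnit B
  set l : Ultrafilter B := Ultrafilter.of (CStarAlgebra.approximateUnit B) with hl
  have hle : (l : Filter B) ≤ CStarAlgebra.approximateUnit B := Ultrafilter.of_le _
  have hcomp := WeakDual.isCompact_closedBall (𝕜 := ℂ) (E := StrongDual ℂ B) 0 1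
  obtain ⟨e, -, he⟩ := hcomp.ultrafilter_le_nhds
    (l.map fun b => StrongDual.toWeakDual (ι b)) (by
      rw [Ultrafilter.coe_map, le_principal_iff, mem_map]
      filter_upwards [hle hU.eventually_norm] with b hb
      have : ‖ι b‖ ≤ 1 := (NormedSpace.double_dual_bound ℂ B b).trans hb
      simpa using this)
  set e' : Bidual B := WeakDual.toStrongDual e with he'
  have hlim : ∀ φ : StrongDual ℂ B, Tendsto (fun b : B => φ b) l (𝓝 (e' φ)) := fun φ =>
    ((WeakBilin.eval_continuous _ φ).tendsto e).comp (show Tendsto _ (l : Filter B) _ from he)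
  refine ⟨e', fun η => ⟨?_, ?_⟩⟩
  · ext φ
    rw [arens_apply]
    refine tendsto_nhds_unique (hlim _) ?_
    change Tendsto (fun b : B => η (φ ∘L ContinuousLinearMap.mul ℂ B b)) l (𝓝 (η φ))
    refine (η.continuous.tendsto φ).comp ?_
    rw [Metric.tendsto_nhds]
    intro ε hε
    filter_upwards [hle (eventually_norm_translate_le φ (half_pos hε))] with b hb
    rw [dist_comm, dist_eq_norm]
    linarith
  · ext φ
    rw [arens_apply]
    congr 1
    ext a
    change e' (φ ∘L ContinuousLinearMap.mul ℂ B a) = φ a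
    exact tendsto_nhds_unique (hlim _)
      ((φ.continuous.tendsto a).comp ((hU.tendsto_mul_left a).mono_left hle))

variable (B) in
/-- The identity `1` of `B**`. -/
noncomputable def one : Bidual B := Classical.choose (exists_isIdentity B)

theorem one_isIdentity : IsIdentity (one B) := Classical.choose_spec (exists_isIdentity B)

/-- The orthocomplement `p^⊥ = 1 - p` in `B**`. -/
noncomputable def compl (p : Bidual B) : Bidual B := one B - p

end Order

/-- Weak* convergence to `p ∈ B**` of a net in `B`. -/
def TendstoWeakStar {B : Type*} [NonUnitalCStarAlgebra B] {Λ : Type*} [Preorder Λ]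
    (f : Λ → B) (p : Bidual B) : Prop :=
  Tendsto (fun t => StrongDual.toWeakDual (ι (f t))) atTop (𝓝 (StrongDual.toWeakDual p))

/-- `p` is an open projection in `B**`: a projection which is the weak* limit of an increasing net
of positive elements of `B`. (Replacing a net by its range, nets indexed in the universe of `B`
suffice.) -/
def IsOpenProjection {B : Type u} [NonUnitalCStarAlgebra B] [PartialOrder B]
    (p : Bidual B) : Prop :=
  IsProjection p ∧
    ∃ (Λ : Type u) (_ : Preorder Λ) (_ : IsDirectedOrder Λ) (_ : Nonempty Λ) (f : Λ → B),
      (∀ t, 0 ≤ f t) ∧ Monotone f ∧ TendstoWeakStar f p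

/-- The weak* closure in `B**` of a subset of `B`. -/
def weakStarClosure {B : Type*} [NonUnitalCStarAlgebra B] (S : Set B) : Set (Bidual B) :=
  {η | StrongDual.toWeakDual η ∈ closure ((fun b => StrongDual.toWeakDual (ι b)) '' S)}

/-- `p` is the support projection of `D ⊆ B`: the identity of the weak* closure of `D` in `B**`. -/
def IsSupportProjection {B : Type*} [NonUnitalCStarAlgebra B] (S : Set B) (p : Bidual B) : Prop :=
  p ∈ weakStarClosure S ∧ ∀ η ∈ weakStarClosure S, arens p η = η ∧ arens η p = η

/-- The element `q x q` of `B**`, for `q ∈ B**` and `x ∈ B`. -/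
noncomputable def corner {B : Type*} [NonUnitalCStarAlgebra B] (q : Bidual B) (x : B) : Bidual B :=
  arens (arens q (ι x)) q

end Bidual

/-- `D` is a hereditary C⋆-subalgebra of `B`. -/
def IsHereditarySubalgebra {B : Type*} [NonUnitalCStarAlgebra B] [PartialOrder B]
    (D : NonUnitalStarSubalgebra ℂ B) : Prop :=
  IsClosed (D : Set B) ∧ ∀ a b : B, 0 ≤ a → a ≤ b → b ∈ D → a ∈ D

/-- The net `f` is a contractive approximate identity (cai) for `D`. -/
def IsCAI {B : Type*} [NonUnitalCStarAlgebra B] {Λ : Type*} [Preorder Λ]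
    (D : NonUnitalStarSubalgebra ℂ B) (f : Λ → B) : Prop :=
  (∀ t, f t ∈ D ∧ ‖f t‖ ≤ 1) ∧
    ∀ a ∈ D, Tendsto (fun t => f t * a) atTop (𝓝 a) ∧ Tendsto (fun t => a * f t) atTop (𝓝 a)

/-- The element `(1 - e) x (1 - e)`, computed in the C⋆-unitization of `B`. -/
noncomputable def compress {B : Type*} [NonUnitalCStarAlgebra B] (e x : B) : Unitization ℂ B :=
  (1 - (e : Unitization ℂ B)) * (x : Unitization ℂ B) * (1 - (e : Unitization ℂ B))

/-- `e ∈ ½𝔉_B`, that is, `‖1 - 2e‖ ≤ 1` in the C⋆-unitization of `B`. -/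
def MemHalfF {B : Type*} [NonUnitalCStarAlgebra B] (e : B) : Prop :=
  ‖1 - (2 : ℂ) • (e : Unitization ℂ B)‖ ≤ 1

/-- `A` is a norm-closed Jordan subalgebra of `B`: a closed subspace that is closed under
squares. -/
def IsClosedJordanSubalgebra {B : Type*} [NonUnitalCStarAlgebra B] (A : Submodule ℂ B) : Prop :=
  IsClosed (A : Set B) ∧ ∀ a ∈ A, a * a ∈ A

/-! Both halves reduce to one notion, `IsSelfUnit`: `e_t → p` weak*, `‖1 - e_t‖` is eventually at
most `1 + ε`, and for each `s` both `e_t e_s` and `e_s e_t` tend to `e_s` in norm. Passing to weak*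
limits, `q` kills every `e_s` on both sides and `x ↦ qxq` is contractive.

For such a net let `J` be the span of all `e_s B` and `B e_s`. A functional vanishing on `J` takes
the same value on `x` and on `qxq`, so Hahn-Banach gives `d(x, J) ≤ ‖qxq‖`. Compressions `(1 - e_t)
y (1 - e_t)` vanish asymptotically on `J` and are almost contractive, so their limsup at `x` is at
most `‖qxq‖`. Conversely `x - (1 - e_t) x (1 - e_t)` lies in `I_A`, whence `‖qxq‖ ≤ d(x, I_A) ≤ ‖(1
- e_t) x (1 - e_t)‖` for every `t`, and everything is squeezed.

For `e_t ∈ ½𝔉_B` the work is in upgrading weak* convergence to norm convergence of `e_t e_s`. Since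
`e* e ≤ Re e`, one has `|(1 - e_t) y|² ≤ y* (1 - Re e_t) y`, a decreasing net, and a Dini argument
only asks that positive functionals tend to zero on it. That is checked in GNS representations,
where the limit `p` becomes an idempotent fixing the range of `e_s`.

For an approximate identity of `D`, only weak* convergence and the bound on `‖1 - f_t‖` need proof;
the latter is not immediate because the `f_t` are not assumed positive. -/

/-! ### A Dini theorem for decreasing nets in a C⋆-algebra. -/

section PositiveFunctionals

open scoped ComplexOrder InnerProductSpace

variable {B : Type*} [NonUnitalCStarAlgebra B] [PartialOrder B] [StarOrderedRing B]
  {Λ : Type*} [Preorder Λ] [IsDirectedOrder Λ] [Nonempty Λ]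

/-- A continuous functional with nonnegative real part on the positive cone restricts to a positive
functional: its hermitian part. -/
theorem exists_positiveLinearMap_eq_re (f : StrongDual ℂ B) (hf : ∀ x : B, 0 ≤ x → 0 ≤ (f x).re) :
    ∃ φ : B →ₚ[ℂ] ℂ, ∀ x : B, IsSelfAdjoint x → φ x = ((f x).re : ℂ) := by
  have key : ∀ x : B, IsSelfAdjoint x →
      ((2⁻¹ : ℂ) • (f + Bidual.dualStar f)) x = ((f x).re : ℂ) := by
    intro x hx
    have h := Complex.add_conj (f x)
    simp only [smul_apply, add_apply,
      Bidual.dualStar_apply, hx.star_eq, smul_eq_mul]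
    rw [Complex.star_def, h]
    push_cast
    ring
  refine ⟨PositiveLinearMap.mk₀
    (((2⁻¹ : ℂ) • (f + Bidual.dualStar f) : StrongDual ℂ B) : B →ₗ[ℂ] ℂ) fun x hx => ?_, key⟩
  change 0 ≤ ((2⁻¹ : ℂ) • (f + Bidual.dualStar f)) x
  rw [key x hx.isSelfAdjoint]
  exact_mod_cast hf x hx

/-- A Dini theorem: a decreasing net of positive elements on which all positive functionals tend
to zero is norm convergent to zero. -/
theorem tendsto_zero_of_antitone_of_positive {a : Λ → B} (ha : Antitone a) (h0 : ∀ t, 0 ≤ a t)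
    (h : ∀ φ : B →ₚ[ℂ] ℂ, Tendsto (fun t => φ (a t)) atTop (𝓝 0)) :
    Tendsto a atTop (𝓝 0) := by
  rw [Metric.tendsto_nhds]
  intro ε hε
  suffices h : ∃ t, ‖a t‖ < ε by
    obtain ⟨t, ht⟩ := h
    filter_upwards [eventually_ge_atTop t] with s hs
    rw [dist_zero_right]
    exact (CStarAlgebra.norm_le_norm_of_nonneg_of_le (h0 s) (ha hs)).trans_lt ht
  by_contra! hc
  -- `C` absorbs the positive cone, which forces any separating functional to have nonnegative real
  -- part there.
  let C : Set B := {x | ∃ t, a t ≤ x}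
  have hC : Convex ℝ C := by
    rintro x ⟨s, hs⟩ y ⟨t, ht⟩ c d hc0 hd0 hcd
    obtain ⟨r, hsr, htr⟩ := exists_ge_ge s t
    refine ⟨r, ?_⟩
    calc a r = c • a r + d • a r := by rw [← add_smul, hcd, one_smul]
      _ ≤ c • x + d • y := by
        have h1 := (ha hsr).trans hs
        have h2 := (ha htr).trans ht
        exact add_le_add (smul_le_smul_of_nonneg_left h1 hc0)
          (smul_le_smul_of_nonneg_left h2 hd0)
  have hdisj : Disjoint (Metric.ball (0 : B) ε) C := by
    rw [Set.disjoint_left]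
    rintro x hx ⟨t, ht⟩
    rw [mem_ball_zero_iff] at hx
    exact absurd ((CStarAlgebra.norm_le_norm_of_nonneg_of_le (h0 t) ht).trans_lt hx)
      (hc t).not_gt
  obtain ⟨f, u, hf, hg⟩ := RCLike.geometric_hahn_banach_open (𝕜 := ℂ) (convex_ball (0 : B) ε)
    Metric.isOpen_ball hC hdisj
  have hu : 0 < u := by simpa using hf 0 (by simpa using hε)
  obtain ⟨t₀⟩ := ‹Nonempty Λ›
  have hpos : ∀ x : B, 0 ≤ x → 0 ≤ (f x).re := by
    intro x hx
    by_contra! hneg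
    -- With this multiple of `x`, the real part of `f` at `a t₀ + r x` becomes `Re f(a t₀) - |Re f(a
    -- t₀)| ≤ 0 < u`, although the point lies in `C`.
    have hr : 0 ≤ |(f (a t₀)).re| / (-(f x).re) := div_nonneg (abs_nonneg _) (by linarith)
    have h1 := hg (a t₀ + (|(f (a t₀)).re| / (-(f x).re)) • x)
      ⟨t₀, le_add_of_nonneg_right (smul_nonneg hr hx)⟩
    rw [map_add, ← Complex.coe_smul, map_smul] at h1
    simp only [RCLike.re_to_complex, Complex.add_re, smul_eq_mul, Complex.re_ofReal_mul] at h1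
    have h2 : |(f (a t₀)).re| / (-(f x).re) * (f x).re = -|(f (a t₀)).re| := by
      field_simp [hneg.ne]
    have := neg_abs_le (f (a t₀)).re
    have := le_abs_self (f (a t₀)).re
    linarith
  obtain ⟨φ, hφ⟩ := exists_positiveLinearMap_eq_re f hpos
  have hlim := (Complex.continuous_re.tendsto _).comp (h φ)
  have hle : u ≤ (0 : ℂ).re := ge_of_tendsto hlim <| Eventually.of_forall fun t => by
    rw [Function.comp_apply, hφ _ (h0 t).isSelfAdjoint]
    simpa using hg (a t) ⟨t, le_rfl⟩
  simp only [Complex.zero_re] at hle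
  exact absurd hle hu.not_ge

end PositiveFunctionals

/-! ### Extending representations to the bidual. -/

namespace Bidual

section Representation

open scoped ComplexOrder InnerProductSpace

variable {B : Type*} [NonUnitalCStarAlgebra B]

theorem TendstoWeakStar.apply {Λ : Type*} [Preorder Λ] {f : Λ → B} {p : Bidual B}
    (h : TendstoWeakStar f p) (φ : StrongDual ℂ B) :
    Tendsto (fun t => φ (f t)) atTop (𝓝 (p φ)) :=
  ((WeakBilin.eval_continuous _ φ).tendsto (StrongDual.toWeakDual p)).comp h

variable {H : Type*} [NormedAddCommGroup H] [InnerProductSpace ℂ H] [CompleteSpace H]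
  (π : B →⋆ₙₐ[ℂ] (H →L[ℂ] H))

/-- A representation, as a continuous linear map. -/
noncomputable def repCLM : B →L[ℂ] (H →L[ℂ] H) :=
  ⟨(π : B →ₗ[ℂ] (H →L[ℂ] H)), AddMonoidHomClass.continuous_of_bound π 1 fun b => by
    simpa using NonUnitalStarAlgHom.norm_apply_le π b⟩

/-- The functional `b ↦ ⟪η, π(b) ξ⟫`. -/
noncomputable def vectorFunctional (η ξ : H) : StrongDual ℂ B :=
  innerSL ℂ η ∘L ContinuousLinearMap.apply ℂ H ξ ∘L
    repCLM π

theorem vectorFunctional_apply (η ξ : H) (b : B) :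
    vectorFunctional π η ξ b = ⟪η, π b ξ⟫_ℂ := rfl

/-- The value at `ξ` of the operator that extends `π` to `m ∈ B**`. -/
theorem exists_inner_eq_apply_vectorFunctional (m : Bidual B) (ξ : H) :
    ∃ v : H, ∀ η, ⟪η, v⟫_ℂ = m (vectorFunctional π η ξ) := by
  let T : H →L⋆[ℂ] ℂ := m.comp
    (((ContinuousLinearMap.compL ℂ B H ℂ).flip (ContinuousLinearMap.apply ℂ H ξ ∘L
      repCLM π)).comp (innerSL ℂ))
  -- `T` is conjugate linear in `η`; conjugating it gives a functional to which Riesz applies.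
  let S : StrongDual ℂ H := ((starL ℂ : ℂ ≃L⋆[ℂ] ℂ) : ℂ →L⋆[ℂ] ℂ).comp T
  refine ⟨(InnerProductSpace.toDual ℂ H).symm S, fun η => ?_⟩
  rw [← inner_conj_symm, InnerProductSpace.toDual_symm_apply]
  change (starRingEnd ℂ) (star (m (vectorFunctional π η ξ))) = _
  simp

variable [PartialOrder B] [StarOrderedRing B]
  {Λ : Type*} [Preorder Λ] [IsDirectedOrder Λ] [Nonempty Λ]

/-- In every representation the weak* limit of an increasing net, if idempotent, dominates the
range of any element `c` whose `c c*` is dominated by a term of the net. -/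
theorem tendsto_inner_of_idempotent {h : Λ → B} (hmono : Monotone h) {p : Bidual B}
    (hp : arens p p = p) (hlim : TendstoWeakStar h p) {c : B} {r : Λ} (hc : c * star c ≤ h r)
    (η ξ : H) :
    Tendsto (fun t => ⟪π c η, π (h t) ξ⟫_ℂ) atTop (𝓝 ⟪π c η, ξ⟫_ℂ) := by
  choose P hP using exists_inner_eq_apply_vectorFunctional π p
  have hPlim : ∀ η ξ, Tendsto (fun t => ⟪η, π (h t) ξ⟫_ℂ) atTop (𝓝 ⟪η, P ξ⟫_ℂ) := fun η ξ => by
    rw [hP]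
    exact hlim.apply (vectorFunctional π η ξ)
  have hadj : ∀ (b : B) (η ξ : H), ⟪η, π b ξ⟫_ℂ = ⟪π (star b) η, ξ⟫_ℂ := fun b η ξ => by
    rw [map_star, ContinuousLinearMap.star_eq_adjoint, ContinuousLinearMap.adjoint_inner_left]
  -- The Arens product becomes composition of operators, so `p² = p` gives `P² = P`.
  have hPP : ∀ ξ, P (P ξ) = P ξ := fun ξ => by
    refine ext_inner_left ℂ fun η => ?_
    rw [hP, hP]
    conv_rhs => rw [← hp, arens_apply]
    congr 1
    ext a
    change ⟪η, π a (P ξ)⟫_ℂ = p _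
    rw [hadj, hP]
    congr 1
    ext b
    change _ = ⟪η, π (a * b) ξ⟫_ℂ
    rw [map_mul, mul_apply_eq_comp, vectorFunctional_apply, hadj a]
  have hsub : ∀ ξ₁ ξ₂, P (ξ₁ - ξ₂) = P ξ₁ - P ξ₂ := fun ξ₁ ξ₂ => by
    refine ext_inner_left ℂ fun η => ?_
    refine tendsto_nhds_unique (hPlim _ _) ?_
    simp only [map_sub, inner_sub_right]
    exact (hPlim _ _).sub (hPlim _ _)
  have hpos : ∀ (b : B), 0 ≤ b → ∀ ζ : H, 0 ≤ (⟪ζ, π b ζ⟫_ℂ).re := fun b hb ζ => by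
    obtain ⟨d, rfl⟩ := CStarAlgebra.nonneg_iff_eq_star_mul_self.1 hb
    rw [map_mul, mul_apply_eq_comp, hadj, star_star]
    exact inner_self_nonneg (𝕜 := ℂ)
  have hle : ∀ (b₁ b₂ : B), b₁ ≤ b₂ → ∀ ζ : H, (⟪ζ, π b₁ ζ⟫_ℂ).re ≤ (⟪ζ, π b₂ ζ⟫_ℂ).re :=
    fun b₁ b₂ hb ζ => by
      have := hpos (b₂ - b₁) (sub_nonneg.2 hb) ζ
      rw [map_sub, sub_apply, inner_sub_right, Complex.sub_re] at this
      linarith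
  -- For `δ = ζ - Pζ`, `‖π(c*) δ‖² = ⟪δ, π(c c*) δ⟫ ≤ ⟪δ, π(h t) δ⟫ → ⟪δ, Pδ⟫ = 0`.
  have hzero : ∀ ζ : H, π (star c) (ζ - P ζ) = 0 := fun ζ => by
    set δ := ζ - P ζ with hδ
    have hPδ : P δ = 0 := by rw [hδ, hsub, hPP, sub_self]
    have h1 : (⟪δ, π (c * star c) δ⟫_ℂ).re ≤ 0 := by
      have hl := (Complex.continuous_re.tendsto _).comp (hPlim δ δ)
      rw [hPδ, inner_zero_right, Complex.zero_re] at hl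
      refine ge_of_tendsto hl ?_
      filter_upwards [eventually_ge_atTop r] with t ht
      exact hle _ _ (hc.trans (hmono ht)) δ
    rw [map_mul, mul_apply_eq_comp, hadj] at h1
    exact norm_eq_zero.1 (pow_eq_zero_iff two_ne_zero |>.1
      (le_antisymm ((inner_self_eq_norm_sq (𝕜 := ℂ) _).symm.trans_le h1) (sq_nonneg _)))
  have hfin : ⟪π c η, P ξ⟫_ℂ = ⟪π c η, ξ⟫_ℂ := by
    have h1 := hadj (star c) η (ξ - P ξ)
    rw [hzero, inner_zero_right, star_star, inner_sub_right] at h1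
    exact (sub_eq_zero.1 h1.symm).symm
  rw [← hfin]
  exact hPlim _ _

end Representation

end Bidual

/-! ### From weak* limits to norm convergence. -/

section RelativeUnit

open scoped ComplexOrder InnerProductSpace

variable {B : Type*} [NonUnitalCStarAlgebra B] [PartialOrder B] [StarOrderedRing B]
  {Λ : Type*} [Preorder Λ] [IsDirectedOrder Λ] [Nonempty Λ]

/-- The hypothesis `he` bounds `|(1 - e t) y|²` by a net decreasing in `t`; by Dini it suffices that
each positive functional sends that net to zero, and the GNS representation shows this when `y` is a
right multiple of `c`. -/
theorem tendsto_sub_mul_of_idempotent_limit {h e : Λ → B} (hmono : Monotone h) {p : Bidual B}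
    (hp : Bidual.arens p p = p) (hlim : Bidual.TendstoWeakStar h p)
    (he : ∀ t y, star (y - e t * y) * (y - e t * y) ≤ star y * y - star y * h t * y)
    (hn : ∀ t y, ‖y - e t * y‖ ≤ ‖y‖) {c : B} {r : Λ} (hc : c * star c ≤ h r) :
    Tendsto (fun t => c - e t * c) atTop (𝓝 0) := by
  -- The factor `b` supplies the GNS vector, there being no unit; it is removed at the end by an
  -- approximate unit and the contractivity `hn`.
  have hb : ∀ b : B, Tendsto (fun t => c * b - e t * (c * b)) atTop (𝓝 0) := by
    intro b
    have hlim0 : Tendsto (fun t => star (c * b) * (c * b) - star (c * b) * h t * (c * b)) atTop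
        (𝓝 0) := by
      refine tendsto_zero_of_antitone_of_positive (fun s t hst => ?_)
        (fun t => (star_mul_self_nonneg _).trans (he t (c * b))) fun φ => ?_
      · exact sub_le_sub_left (star_left_conjugate_le_conjugate (hmono hst) _) _
      · have key := Bidual.tendsto_inner_of_idempotent φ.gnsNonUnitalStarAlgHom hmono hp hlim hc
          (φ.toPreGNS b : φ.GNS) (φ.gnsNonUnitalStarAlgHom c (φ.toPreGNS b : φ.GNS))
        simp only [PositiveLinearMap.gnsNonUnitalStarAlgHom_apply_coe,
          UniformSpace.Completion.inner_coe, PositiveLinearMap.leftMulMapPreGNS_apply,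
          PositiveLinearMap.preGNS_inner_def, PositiveLinearMap.ofPreGNS_toPreGNS] at key
        have h2 := key.const_sub (φ (star (c * b) * (c * b)))
        rw [sub_self] at h2
        refine h2.congr fun t => ?_
        rw [map_sub, mul_assoc]
    rw [tendsto_zero_iff_norm_tendsto_zero] at hlim0 ⊢
    have hsq := hlim0.sqrt
    rw [Real.sqrt_zero] at hsq
    refine squeeze_zero (fun _ => norm_nonneg _) (fun t => ?_) hsq
    refine Real.le_sqrt_of_sq_le ?_
    rw [sq, ← CStarRing.norm_star_mul_self]
    exact CStarAlgebra.norm_le_norm_of_nonneg_of_le (star_mul_self_nonneg _) (he t _)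
  rw [Metric.tendsto_nhds]
  intro ε hε
  have hU := CStarAlgebra.increasingApproximateUnit B
  obtain ⟨b, hbc⟩ := ((Metric.tendsto_nhds.1 (hU.tendsto_mul_left c)) (ε / 2)
    (half_pos hε)).exists
  filter_upwards [(Metric.tendsto_nhds.1 (hb b)) (ε / 2) (half_pos hε)] with t ht
  rw [dist_zero_right] at ht ⊢
  have h1 := hn t (c - c * b)
  rw [dist_comm, dist_eq_norm] at hbc
  calc ‖c - e t * c‖
      = ‖(c * b - e t * (c * b)) + ((c - c * b) - e t * (c - c * b))‖ := by
        congr 1; rw [mul_sub]; abel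
    _ ≤ ‖c * b - e t * (c * b)‖ + ‖(c - c * b) - e t * (c - c * b)‖ := norm_add_le _ _
    _ < ε := by linarith

end RelativeUnit

/-! ### Algebra of the Arens product. -/

namespace Bidual

section Arens

variable {B : Type*} [NonUnitalCStarAlgebra B]

theorem arens_assoc (m n k : Bidual B) : arens (arens m n) k = arens m (arens n k) := by
  ext φ
  simp only [arens_apply]
  congr 1
  ext a
  change n _ = n _
  congr 1
  ext b
  change k _ = k _
  congr 1
  ext c
  exact congrArg φ (mul_assoc a b c)

theorem arens_sub_left (m n k : Bidual B) : arens (m - n) k = arens m k - arens n k := rfl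

theorem arens_sub_right (m n k : Bidual B) : arens m (n - k) = arens m n - arens m k := by
  ext φ
  simp only [arens_apply, sub_apply]
  rw [← map_sub]
  rfl

theorem arens_zero_left (k : Bidual B) : arens 0 k = 0 := rfl

theorem arens_zero_right (m : Bidual B) : arens m 0 = 0 := by
  have h := arens_sub_right m 0 0
  rw [sub_self (0 : Bidual B)] at h
  exact h.trans (sub_self (arens m 0))

theorem arens_ι_right_apply (m : Bidual B) (a : B) (φ : StrongDual ℂ B) :
    arens m (ι a) φ = m (φ ∘L (ContinuousLinearMap.mul ℂ B).flip a) := rfl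

theorem arens_ι_left_apply (m : Bidual B) (a : B) (φ : StrongDual ℂ B) :
    arens (ι a) m φ = m (φ ∘L ContinuousLinearMap.mul ℂ B a) := rfl

theorem ι_apply (a : B) (φ : StrongDual ℂ B) : ι a φ = φ a := rfl

theorem ι_sub (a b : B) : ι (a - b) = ι a - ι b :=
  ContinuousLinearMap.ext fun φ => φ.map_sub a b

theorem ι_mul (a b : B) : ι (a * b) = arens (ι a) (ι b) := rfl

theorem norm_ι_le (a : B) : ‖ι a‖ ≤ ‖a‖ := NormedSpace.double_dual_bound ℂ B a

theorem corner_sub (q : Bidual B) (x y : B) : corner q (x - y) = corner q x - corner q y := by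
  simp only [corner, ι_sub, arens_sub_right, arens_sub_left]

theorem corner_zero (q : Bidual B) : corner q 0 = 0 := by
  have h := corner_sub q 0 0
  rw [sub_self (0 : B)] at h
  exact h.trans (sub_self (corner q 0))

theorem corner_mul_of_left {q : Bidual B} {a : B} (h : arens q (ι a) = 0) (b : B) :
    corner q (a * b) = 0 := by
  rw [corner, ι_mul, ← arens_assoc, h, arens_zero_left, arens_zero_left]

theorem corner_mul_of_right {q : Bidual B} {a : B} (h : arens (ι a) q = 0) (b : B) :
    corner q (b * a) = 0 := by
  rw [corner, ι_mul, arens_assoc, arens_assoc, h, arens_zero_right, arens_zero_right]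

end Arens

section Compl

variable {B : Type*} [NonUnitalCStarAlgebra B] [PartialOrder B] [StarOrderedRing B]

theorem arens_compl_left (p η : Bidual B) : arens p.compl η = η - arens p η := by
  rw [compl, arens_sub_left, (one_isIdentity η).1]

theorem arens_compl_right (p η : Bidual B) : arens η p.compl = η - arens η p := by
  rw [compl, arens_sub_right, (one_isIdentity η).2]

end Compl

end Bidual

/-! ### Compressions `(1 - e) x (1 - e)`. -/

section Compress

variable {B : Type*} [NonUnitalCStarAlgebra B]

theorem compress_eq_inr (e x : B) :
    compress e x = ((x - e * x - (x - e * x) * e : B) : Unitization ℂ B) := by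
  simp only [compress, Unitization.inr_sub, Unitization.inr_mul]
  noncomm_ring

theorem norm_sub_mul_left_le (e x : B) :
    ‖x - e * x‖ ≤ ‖1 - (e : Unitization ℂ B)‖ * ‖x‖ := by
  rw [← Unitization.norm_inr (𝕜 := ℂ) x, ← Unitization.norm_inr (𝕜 := ℂ) (x - e * x)]
  refine le_trans (le_of_eq ?_) (norm_mul_le _ _)
  rw [Unitization.inr_sub, Unitization.inr_mul, sub_mul, one_mul]

theorem norm_sub_mul_right_le (e x : B) :
    ‖x - x * e‖ ≤ ‖1 - (e : Unitization ℂ B)‖ * ‖x‖ := by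
  rw [← Unitization.norm_inr (𝕜 := ℂ) x, ← Unitization.norm_inr (𝕜 := ℂ) (x - x * e), mul_comm]
  refine le_trans (le_of_eq ?_) (norm_mul_le _ _)
  rw [Unitization.inr_sub, Unitization.inr_mul, mul_sub, mul_one]

theorem norm_compress (e x : B) : ‖compress e x‖ = ‖x - e * x - (x - e * x) * e‖ := by
  rw [compress_eq_inr, Unitization.norm_inr]

theorem norm_compress_le (e x : B) :
    ‖compress e x‖ ≤ ‖1 - (e : Unitization ℂ B)‖ ^ 2 * ‖x‖ := by
  rw [norm_compress, sq, mul_assoc]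
  exact (norm_sub_mul_right_le _ _).trans
    (mul_le_mul_of_nonneg_left (norm_sub_mul_left_le _ _) (norm_nonneg _))

theorem compress_add (e x y : B) : compress e (x + y) = compress e x + compress e y := by
  simp only [compress, Unitization.inr_add, mul_add, add_mul]

theorem compress_smul (e : B) (c : ℂ) (x : B) : compress e (c • x) = c • compress e x := by
  simp only [compress, Unitization.inr_smul, mul_smul_comm, smul_mul_assoc]

end Compress

/-! ### Distance formula for asymptotic self-units. -/

section Core

variable {B : Type*} [NonUnitalCStarAlgebra B]
  {Λ : Type*} [Preorder Λ]

/-- The net `e` is asymptotically a contractive relative unit for itself, with weak* limit `p`. -/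
structure IsSelfUnit (e : Λ → B) (p : Bidual B) : Prop where
  tendsto_weakStar : Bidual.TendstoWeakStar e p
  eventually_norm_le : ∀ ε > 0, ∀ᶠ t in atTop, ‖1 - (e t : Unitization ℂ B)‖ ≤ 1 + ε
  tendsto_left : ∀ s, Tendsto (fun t => e s - e t * e s) atTop (𝓝 0)
  tendsto_right : ∀ s, Tendsto (fun t => e s - e s * e t) atTop (𝓝 0)

namespace IsSelfUnit

open Bidual

variable {e : Λ → B} {p : Bidual B}

/-- The span of the products, on either side, of terms of the net with elements of `B`. -/
def products (e : Λ → B) : Submodule ℂ B :=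
  Submodule.span ℂ {y | ∃ s b, y = e s * b ∨ y = b * e s}

theorem tendsto_compress_of_mem_products (h : IsSelfUnit e p) {y : B} (hy : y ∈ products e) :
    Tendsto (fun t => compress (e t) y) atTop (𝓝 0) := by
  induction hy using Submodule.span_induction with
  | mem y hy =>
    rw [tendsto_zero_iff_norm_tendsto_zero]
    obtain ⟨s, b, rfl | rfl⟩ := hy
    · have hlim := ((h.tendsto_left s).norm.mul_const ‖b‖).const_mul 2
      rw [norm_zero, zero_mul, mul_zero] at hlim
      refine squeeze_zero' (Eventually.of_forall fun _ => norm_nonneg _) ?_ hlim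
      filter_upwards [h.eventually_norm_le 1 one_pos] with t ht
      rw [norm_compress]
      calc _ ≤ ‖1 - (e t : Unitization ℂ B)‖ * ‖e s * b - e t * (e s * b)‖ := norm_sub_mul_right_le _ _
        _ ≤ 2 * (‖e s - e t * e s‖ * ‖b‖) := by
          rw [← mul_assoc, ← sub_mul]
          exact mul_le_mul (by linarith) (norm_mul_le _ _) (norm_nonneg _) zero_le_two
    · have hlim := ((h.tendsto_right s).norm.const_mul ‖b‖).const_mul 2
      rw [norm_zero, mul_zero, mul_zero] at hlim
      refine squeeze_zero' (Eventually.of_forall fun _ => norm_nonneg _) ?_ hlim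
      filter_upwards [h.eventually_norm_le 1 one_pos] with t ht
      rw [norm_compress]
      have heq : b * e s - e t * (b * e s) - (b * e s - e t * (b * e s)) * e t
          = b * (e s - e s * e t) - e t * (b * (e s - e s * e t)) := by noncomm_ring
      rw [heq]
      calc _ ≤ ‖1 - (e t : Unitization ℂ B)‖ * ‖b * (e s - e s * e t)‖ := norm_sub_mul_left_le _ _
        _ ≤ 2 * (‖b‖ * ‖e s - e s * e t‖) :=
          mul_le_mul (by linarith) (norm_mul_le _ _) (norm_nonneg _) zero_le_two
  | zero => simpa [compress] using tendsto_const_nhds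
  | add x y _ _ hx hy => simpa only [compress_add, add_zero] using hx.add hy
  | smul c x _ hx => simpa only [compress_smul, smul_zero] using hx.const_smul c

variable [PartialOrder B] [StarOrderedRing B] [IsDirectedOrder Λ] [Nonempty Λ]

theorem arens_compl_ι (h : IsSelfUnit e p) (s : Λ) : arens p.compl (ι (e s)) = 0 := by
  ext φ
  rw [arens_compl_left, sub_apply, arens_ι_right_apply]
  have h1 := h.tendsto_weakStar.apply (φ ∘L (ContinuousLinearMap.mul ℂ B).flip (e s))
  have h2 := (φ.continuous.tendsto 0).comp (h.tendsto_left s)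
  rw [map_zero] at h2
  refine tendsto_nhds_unique (h1.const_sub (ι (e s) φ)) (h2.congr fun t => ?_)
  simp [ι_apply]

theorem arens_ι_compl (h : IsSelfUnit e p) (s : Λ) : arens (ι (e s)) p.compl = 0 := by
  ext φ
  rw [arens_compl_right, sub_apply, arens_ι_left_apply]
  have h1 := h.tendsto_weakStar.apply (φ ∘L ContinuousLinearMap.mul ℂ B (e s))
  have h2 := (φ.continuous.tendsto 0).comp (h.tendsto_right s)
  rw [map_zero] at h2
  refine tendsto_nhds_unique (h1.const_sub (ι (e s) φ)) (h2.congr fun t => ?_)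
  simp [ι_apply]

/-- Left multiplication by `1 - e t` has norm at most `1 + ε`, and this bound survives the weak*
limit. -/
theorem norm_arens_compl_left_le (h : IsSelfUnit e p) (η : Bidual B) :
    ‖arens p.compl η‖ ≤ ‖η‖ := by
  refine ContinuousLinearMap.opNorm_le_bound _ (norm_nonneg η) fun φ => ?_
  rw [arens_compl_left, sub_apply, arens_apply]
  have h1 := ((h.tendsto_weakStar.apply
    (η ∘L (ContinuousLinearMap.compL ℂ B B ℂ φ ∘L ContinuousLinearMap.mul ℂ B))).const_sub
      (η φ)).norm
  refine le_of_forall_pos_le_add fun δ hδ => ?_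
  set M := ‖η‖ * ‖φ‖ with hM
  have hM0 : 0 ≤ M := by positivity
  -- Chosen so that `M ε ≤ δ`, with `M + 1` allowing `M = 0`.
  have hε : 0 < δ / (M + 1) := by positivity
  refine le_of_tendsto h1 ?_
  filter_upwards [h.eventually_norm_le _ hε] with t ht
  change ‖η φ - η (φ ∘L ContinuousLinearMap.mul ℂ B (e t))‖ ≤ _
  rw [← map_sub]
  have h2 : ‖φ - φ ∘L ContinuousLinearMap.mul ℂ B (e t)‖ ≤ ‖φ‖ * (1 + δ / (M + 1)) := by
    refine ContinuousLinearMap.opNorm_le_bound _ (by positivity) fun b => ?_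
    change ‖φ b - φ (e t * b)‖ ≤ _
    rw [← map_sub, mul_assoc]
    refine (φ.le_opNorm _).trans (mul_le_mul_of_nonneg_left ?_ (norm_nonneg _))
    exact (norm_sub_mul_left_le _ _).trans (mul_le_mul_of_nonneg_right ht (norm_nonneg _))
  calc _ ≤ ‖η‖ * (‖φ‖ * (1 + δ / (M + 1))) :=
        (η.le_opNorm _).trans (mul_le_mul_of_nonneg_left h2 (norm_nonneg _))
    _ = M + M / (M + 1) * δ := by rw [hM]; ring
    _ ≤ M + δ := by
      gcongr
      exact mul_le_of_le_one_left hδ.le ((div_le_one (by positivity)).2 (by linarith))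

theorem norm_arens_compl_right_le (h : IsSelfUnit e p) (η : Bidual B) :
    ‖arens η p.compl‖ ≤ ‖η‖ := by
  refine ContinuousLinearMap.opNorm_le_bound _ (norm_nonneg η) fun φ => ?_
  rw [arens_compl_right, sub_apply, arens_apply, ← map_sub]
  refine (η.le_opNorm _).trans (mul_le_mul_of_nonneg_left ?_ (norm_nonneg _))
  refine ContinuousLinearMap.opNorm_le_bound _ (norm_nonneg _) fun b => ?_
  change ‖φ b - p (φ ∘L ContinuousLinearMap.mul ℂ B b)‖ ≤ _
  have h1 := ((h.tendsto_weakStar.apply (φ ∘L ContinuousLinearMap.mul ℂ B b)).const_sub (φ b)).norm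
  refine le_of_forall_pos_le_add fun δ hδ => ?_
  set M := ‖φ‖ * ‖b‖ with hM
  have hM0 : 0 ≤ M := by positivity
  have hε : 0 < δ / (M + 1) := by positivity
  refine le_of_tendsto h1 ?_
  filter_upwards [h.eventually_norm_le _ hε] with t ht
  change ‖φ b - φ (b * e t)‖ ≤ _
  rw [← map_sub]
  calc _ ≤ ‖φ‖ * ((1 + δ / (M + 1)) * ‖b‖) :=
        (φ.le_opNorm _).trans (mul_le_mul_of_nonneg_left
          ((norm_sub_mul_right_le _ _).trans (mul_le_mul_of_nonneg_right ht (norm_nonneg _)))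
          (norm_nonneg _))
    _ = M + M / (M + 1) * δ := by rw [hM]; ring
    _ ≤ M + δ := by
      gcongr
      exact mul_le_of_le_one_left hδ.le ((div_le_one (by positivity)).2 (by linarith))

theorem norm_corner_compl_le (h : IsSelfUnit e p) (x : B) : ‖p.compl.corner x‖ ≤ ‖x‖ :=
  (h.norm_arens_compl_right_le _).trans ((h.norm_arens_compl_left_le _).trans (norm_ι_le x))

/-- The terms `px`, `xp` and `pxp` of `x - qxq` all vanish at `ψ`, because `ψ` kills every `e t * x`
and every `a * e t`. -/
theorem corner_compl_apply_of_vanish (h : IsSelfUnit e p) {ψ : StrongDual ℂ B}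
    (hψ : ∀ y ∈ products e, ψ y = 0) (x : B) : p.compl.corner x ψ = ψ x := by
  have hr : ∀ a, p (ψ ∘L ContinuousLinearMap.mul ℂ B a) = 0 := fun a => by
    refine tendsto_nhds_unique (h.tendsto_weakStar.apply _) ?_
    refine tendsto_const_nhds.congr fun t => ?_
    exact (hψ (a * e t) (Submodule.subset_span ⟨t, a, Or.inr rfl⟩)).symm
  have hl : p (ψ ∘L (ContinuousLinearMap.mul ℂ B).flip x) = 0 := by
    refine tendsto_nhds_unique (h.tendsto_weakStar.apply _) ?_
    refine tendsto_const_nhds.congr fun t => ?_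
    exact (hψ (e t * x) (Submodule.subset_span ⟨t, x, Or.inl rfl⟩)).symm
  have h0 : p ∘L (ContinuousLinearMap.compL ℂ B B ℂ ψ ∘L ContinuousLinearMap.mul ℂ B) = 0 := by
    ext a
    exact hr a
  rw [corner, arens_compl_right, sub_apply, arens_apply _ p, h0, map_zero, sub_zero,
    arens_compl_left, sub_apply, arens_ι_right_apply, hl, sub_zero, ι_apply]

/-- The upper estimate: limsup of the compressions is at most the quotient seminorm of `x` modulo
`products e`, which Hahn-Banach bounds by `‖qxq‖`. -/
theorem eventually_norm_compress_lt (h : IsSelfUnit e p) (x : B) {c : ℝ}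
    (hc : ‖p.compl.corner x‖ < c) : ∀ᶠ t in atTop, ‖compress (e t) x‖ < c := by
  let J := products e
  have hx : ‖(Submodule.Quotient.mk x : B ⧸ J)‖ < c := by
    obtain ⟨g, hg1, hg⟩ := exists_dual_vector'' ℂ (Submodule.Quotient.mk x : B ⧸ J)
    let Q : B →L[ℂ] B ⧸ J := J.mkQ.mkContinuous 1 fun b => by
      rw [one_mul]
      exact Submodule.Quotient.norm_mk_le J b
    have hQ : ‖Q‖ ≤ 1 := J.mkQ.mkContinuous_norm_le zero_le_one _
    have hψ : ‖g ∘L Q‖ ≤ 1 := (g.opNorm_comp_le Q).trans (mul_le_one₀ hg1 (norm_nonneg _) hQ)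
    have h1 := h.corner_compl_apply_of_vanish (ψ := g ∘L Q) (fun y hy => by
      change g (Submodule.Quotient.mk y) = 0
      rw [(Submodule.Quotient.mk_eq_zero J).2 hy, map_zero]) x
    have h2 : ‖(Submodule.Quotient.mk x : B ⧸ J)‖ ≤ ‖p.compl.corner x‖ := by
      calc ‖(Submodule.Quotient.mk x : B ⧸ J)‖ = ‖(g ∘L Q) x‖ := by
            change _ = ‖g (Submodule.Quotient.mk x)‖
            rw [hg]; simp
        _ ≤ ‖p.compl.corner x‖ * ‖g ∘L Q‖ := by rw [← h1]; exact ContinuousLinearMap.le_opNorm _ _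
        _ ≤ ‖p.compl.corner x‖ := mul_le_of_le_one_right (norm_nonneg (p.compl.corner x)) hψ
    exact h2.trans_lt hc
  obtain ⟨m, hm, hmc⟩ := Submodule.Quotient.norm_mk_lt (Submodule.Quotient.mk x : B ⧸ J)
    (sub_pos.2 hx)
  rw [add_sub_cancel] at hmc
  have hy : x - m ∈ J := (Submodule.Quotient.eq J).1 hm.symm
  -- Half of the gap `c - ‖m‖` pays for the factor `(1 + ε) ^ 2` on `m`, half for the compression of
  -- `x - m`.
  set δ := (c - ‖m‖) / 2 with hδ
  have hδ0 : 0 < δ := by rw [hδ]; linarith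
  have hcont : Tendsto (fun ε : ℝ => (1 + ε) ^ 2 * ‖m‖) (𝓝[>] 0) (𝓝 ((1 + 0) ^ 2 * ‖m‖)) :=
    (Continuous.tendsto (by fun_prop) 0).mono_left nhdsWithin_le_nhds
  obtain ⟨ε, hε, hε0⟩ := ((hcont.eventually (gt_mem_nhds (show (1 + 0) ^ 2 * ‖m‖ < ‖m‖ + δ by linarith))).and
    self_mem_nhdsWithin).exists
  filter_upwards [h.eventually_norm_le ε hε0, (Metric.tendsto_nhds.1
    (h.tendsto_compress_of_mem_products hy)) δ hδ0] with t ht1 ht2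
  rw [dist_zero_right] at ht2
  have h3 : ‖compress (e t) m‖ ≤ (1 + ε) ^ 2 * ‖m‖ :=
    (norm_compress_le _ _).trans (by gcongr)
  calc ‖compress (e t) x‖ = ‖compress (e t) m + compress (e t) (x - m)‖ := by
        rw [← compress_add, add_sub_cancel]
    _ ≤ ‖compress (e t) m‖ + ‖compress (e t) (x - m)‖ := norm_add_le _ _
    _ < c := by linarith

theorem infDist_eq_and_tendsto (h : IsSelfUnit e p) {A : Submodule ℂ B}
    (hA : ∀ t, ∀ x ∈ A, x - e t * x - (x - e t * x) * e t ∈ A) {x : B} (hx : x ∈ A) :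
    Tendsto (fun t => ‖compress (e t) x‖) atTop
        (𝓝 (Metric.infDist x {a : B | a ∈ A ∧ p.compl.corner a = 0})) ∧
      Metric.infDist x {a : B | a ∈ A ∧ p.compl.corner a = 0} = ‖p.compl.corner x‖ := by
  set S := {a : B | a ∈ A ∧ p.compl.corner a = 0} with hS
  have hge : ‖p.compl.corner x‖ ≤ Metric.infDist x S := by
    have hne : S.Nonempty := ⟨0, A.zero_mem, corner_zero _⟩
    refine (Metric.le_infDist hne).2 fun y hy => ?_
    rw [dist_eq_norm, ← sub_zero (p.compl.corner x), ← hy.2, ← corner_sub]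
    exact h.norm_corner_compl_le _
  have hle : ∀ t, Metric.infDist x S ≤ ‖compress (e t) x‖ := fun t => by
    have hmem : x - (x - e t * x - (x - e t * x) * e t) ∈ S := by
      refine ⟨A.sub_mem hx (hA t x hx), ?_⟩
      have heq : x - (x - e t * x - (x - e t * x) * e t)
          = e t * x - (e t * x - x) * e t := by noncomm_ring
      rw [heq, corner_sub, corner_mul_of_left (h.arens_compl_ι t),
        corner_mul_of_right (h.arens_ι_compl t)]
      exact sub_self (0 : Bidual B)
    refine (Metric.infDist_le_dist_of_mem hmem).trans_eq ?_
    rw [dist_eq_norm, sub_sub_cancel, norm_compress]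
  have hlim : Tendsto (fun t => ‖compress (e t) x‖) atTop (𝓝 ‖p.compl.corner x‖) :=
    tendsto_order.2 ⟨fun c hc => Eventually.of_forall fun t => hc.trans_le (hge.trans (hle t)),
      fun c hc => h.eventually_norm_compress_lt x hc⟩
  have heq : Metric.infDist x S = ‖p.compl.corner x‖ :=
    le_antisymm (ge_of_tendsto' hlim hle) hge
  exact ⟨heq ▸ hlim, heq⟩

theorem tendsto_compress_of_corner_eq_zero (h : IsSelfUnit e p) {x : B}
    (hx : p.compl.corner x = 0) : Tendsto (fun t => compress (e t) x) atTop (𝓝 0) := by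
  rw [Metric.tendsto_nhds]
  intro ε hε
  have hc : ‖p.compl.corner x‖ < ε := by
    rw [hx]
    exact (norm_zero (E := Bidual B)).trans_lt hε
  simpa only [dist_zero_right] using h.eventually_norm_compress_lt x hc

end IsSelfUnit

end Core

/-! ### Nets in `½𝔉_B`. -/

namespace Bidual

variable {B : Type*} [NonUnitalCStarAlgebra B] {Λ : Type*} [Preorder Λ]

theorem tendstoWeakStar_of_apply {f : Λ → B} {p : Bidual B}
    (h : ∀ φ : StrongDual ℂ B, Tendsto (fun t => φ (f t)) atTop (𝓝 (p φ))) :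
    TendstoWeakStar f p :=
  (WeakBilin.tendsto_iff_forall_eval_tendsto _ ContinuousLinearMap.coe_injective).2 h

/-- The adjoints `(e t)*` converge weak* to `p* = p`, so the averages do too. -/
theorem IsProjection.tendstoWeakStar_realPart {p : Bidual B} (hp : p.IsProjection) {e : Λ → B}
    (he : TendstoWeakStar e p) : TendstoWeakStar (fun t => (realPart (e t) : B)) p := by
  refine tendstoWeakStar_of_apply fun φ => ?_
  have h1 := ((he.apply φ).add (he.apply (dualStar φ)).star).const_mul (2⁻¹ : ℂ)
  rw [hp.2 φ] at h1
  have h2 : (2⁻¹ : ℂ) * (p φ + p φ) = p φ := by ring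
  rw [h2] at h1
  refine h1.congr fun t => ?_
  rw [dualStar_apply, star_star, realPart_apply_coe, ← map_add, ← Complex.coe_smul, map_smul]
  simp

end Bidual

section HalfF

variable {B : Type*} [NonUnitalCStarAlgebra B]

theorem MemHalfF.star {e : B} (he : MemHalfF e) : MemHalfF (star e) := by
  rw [MemHalfF, ← norm_star] at he
  simpa [MemHalfF, Unitization.inr_star] using he

theorem MemHalfF.norm_one_sub_le {e : B} (he : MemHalfF e) :
    ‖1 - (e : Unitization ℂ B)‖ ≤ 1 := by
  have h : 1 - (e : Unitization ℂ B)
      = (2⁻¹ : ℂ) • (1 + (1 - (2 : ℂ) • (e : Unitization ℂ B))) := by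
    module
  rw [h, norm_smul]
  calc _ ≤ ‖(2⁻¹ : ℂ)‖ * (1 + 1) := by
        gcongr
        exact (norm_add_le _ _).trans (add_le_add CStarRing.norm_one.le he)
    _ = 1 := by norm_num

theorem MemHalfF.norm_sub_mul_le {e : B} (he : MemHalfF e) (y : B) : ‖y - e * y‖ ≤ ‖y‖ :=
  (norm_sub_mul_left_le e y).trans (mul_le_of_le_one_left (norm_nonneg _) he.norm_one_sub_le)

theorem realPart_star_coe (e : B) : (realPart (Star.star e) : B) = (realPart e : B) := by
  rw [realPart_apply_coe, realPart_apply_coe, star_star, add_comm]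

variable [PartialOrder B] [StarOrderedRing B]

/-- Expanding `(1 - 2e)* (1 - 2e) ≤ 1` gives `4 e* e ≤ 2e + 2e* = 4 Re e`. -/
theorem MemHalfF.star_mul_self_le {e : B} (he : MemHalfF e) :
    Star.star e * e ≤ (realPart e : B) := by
  have h1 : Star.star (1 - (2 : ℂ) • (e : Unitization ℂ B)) * (1 - (2 : ℂ) • (e : Unitization ℂ B))
      ≤ 1 := by
    refine (CStarAlgebra.norm_le_one_iff_of_nonneg _ (star_mul_self_nonneg _)).1 ?_
    rw [CStarRing.norm_star_mul_self]
    exact mul_le_one₀ he (norm_nonneg _) he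
  have h2 : 1 - Star.star (1 - (2 : ℂ) • (e : Unitization ℂ B)) *
      (1 - (2 : ℂ) • (e : Unitization ℂ B))
      = (((4 : ℝ) • ((realPart e : B) - Star.star e * e) : B) : Unitization ℂ B) := by
    have h3 : (4 : ℝ) • ((realPart e : B) - Star.star e * e)
        = (2 : ℂ) • e + (2 : ℂ) • Star.star e - (4 : ℂ) • (Star.star e * e) := by
      rw [realPart_apply_coe, smul_sub, smul_smul, ← Complex.coe_smul, ← Complex.coe_smul,
        smul_add]
      norm_num
    rw [h3]
    simp only [star_sub, star_one, star_smul, sub_mul, mul_sub, one_mul, mul_one, smul_mul_assoc,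
      mul_smul_comm, star_ofNat, Unitization.inr_sub, Unitization.inr_add, Unitization.inr_smul,
      Unitization.inr_mul, Unitization.inr_star]
    module
  have h4 := sub_nonneg.2 h1
  rw [h2, Unitization.inr_nonneg_iff] at h4
  have h5 := smul_nonneg (show (0 : ℝ) ≤ 4⁻¹ by norm_num) h4
  rw [smul_smul] at h5
  norm_num at h5
  exact h5

/-- `(1 - e)* (1 - e) = 1 - 2 Re e + e* e ≤ 1 - Re e`, conjugated by `y`. -/
theorem MemHalfF.star_mul_self_sub_mul_le {e : B} (he : MemHalfF e) (y : B) :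
    Star.star (y - e * y) * (y - e * y)
      ≤ Star.star y * y - Star.star y * (realPart e : B) * y := by
  have h := star_left_conjugate_nonneg (sub_nonneg.2 he.star_mul_self_le) y
  have hre : e + Star.star e = (realPart e : B) + (realPart e : B) := by
    rw [realPart_apply_coe, ← two_smul ℝ, smul_smul]
    norm_num
  have hre' : (realPart e : B) - Star.star e * e
      = e + Star.star e - (realPart e : B) - Star.star e * e := by
    rw [hre]; abel
  rw [hre'] at h
  rw [← sub_nonneg]
  convert h using 1
  simp only [star_sub, star_mul]
  noncomm_ring

theorem isSelfUnit_of_memHalfF {Λ : Type*} [Preorder Λ] [IsDirectedOrder Λ] [Nonempty Λ]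
    {e : Λ → B} {p : Bidual B} (hp : p.IsProjection) (he : ∀ t, MemHalfF (e t))
    (hmono : Monotone fun t => (realPart (e t) : B)) (hlim : Bidual.TendstoWeakStar e p) :
    IsSelfUnit e p where
  tendsto_weakStar := hlim
  eventually_norm_le ε hε := Eventually.of_forall fun t => (he t).norm_one_sub_le.trans (by linarith)
  tendsto_left s := by
    refine tendsto_sub_mul_of_idempotent_limit hmono hp.1 (hp.tendstoWeakStar_realPart hlim)
      (fun t => (he t).star_mul_self_sub_mul_le) (fun t => (he t).norm_sub_mul_le) (r := s) ?_
    simpa only [star_star, realPart_star_coe] using (he s).star.star_mul_self_le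
  tendsto_right s := by
    -- The adjoint net is again in `½𝔉_B` with the same real parts; taking adjoints of its left-hand
    -- limit gives the right-hand one.
    have h := tendsto_sub_mul_of_idempotent_limit hmono hp.1 (hp.tendstoWeakStar_realPart hlim)
      (e := fun t => Star.star (e t)) (c := Star.star (e s)) (r := s)
      (fun t y => by
        simpa only [realPart_star_coe] using (he t).star.star_mul_self_sub_mul_le y)
      (fun t => (he t).star.norm_sub_mul_le)
      (by simpa only [star_star] using (he s).star_mul_self_le)
    have h2 := h.star
    simpa only [star_sub, star_mul, star_star, star_zero] using h2

end HalfF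

/-! ### Jordan subalgebras are stable under compression. -/

section Jordan

variable {B : Type*} [NonUnitalCStarAlgebra B]

theorem IsClosedJordanSubalgebra.mul_add_mul_mem {A : Submodule ℂ B}
    (hA : IsClosedJordanSubalgebra A) {a b : B} (ha : a ∈ A) (hb : b ∈ A) : a * b + b * a ∈ A := by
  have h := A.sub_mem (A.sub_mem (hA.2 _ (A.add_mem ha hb)) (hA.2 _ ha)) (hA.2 _ hb)
  convert h using 1
  noncomm_ring

/-- With `x ∘ y = xy + yx`, `2aba = a ∘ (a ∘ b) - a² ∘ b`. -/
theorem IsClosedJordanSubalgebra.mul_mul_mem {A : Submodule ℂ B}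
    (hA : IsClosedJordanSubalgebra A) {a b : B} (ha : a ∈ A) (hb : b ∈ A) : a * b * a ∈ A := by
  have h := A.smul_mem (2⁻¹ : ℂ) (A.sub_mem
    (hA.mul_add_mul_mem ha (hA.mul_add_mul_mem ha hb)) (hA.mul_add_mul_mem (hA.2 a ha) hb))
  have heq : a * (a * b + b * a) + (a * b + b * a) * a - (a * a * b + b * (a * a))
      = (2 : ℂ) • (a * b * a) := by
    rw [two_smul]; noncomm_ring
  rwa [heq, smul_smul, inv_mul_cancel₀ two_ne_zero, one_smul] at h

theorem IsClosedJordanSubalgebra.compress_mem {A : Submodule ℂ B}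
    (hA : IsClosedJordanSubalgebra A) {e x : B} (he : e ∈ A) (hx : x ∈ A) :
    x - e * x - (x - e * x) * e ∈ A := by
  have h := A.add_mem (A.sub_mem hx (hA.mul_add_mul_mem he hx)) (hA.mul_mul_mem he hx)
  convert h using 1
  noncomm_ring

end Jordan

/-! ### Increasing approximate identities. -/

section Hereditary

variable {B : Type*} [NonUnitalCStarAlgebra B] {Λ : Type*} [Preorder Λ]
  {D : NonUnitalStarSubalgebra ℂ B} {f : Λ → B}

/-- A contractive approximate identity of an algebra converges weak* to its support projection. -/
theorem IsCAI.tendstoWeakStar [IsDirectedOrder Λ] [Nonempty Λ] (hf : IsCAI D f) {p : Bidual B}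
    (hp : Bidual.IsSupportProjection (D : Set B) p) : Bidual.TendstoWeakStar f p := by
  refine (WeakDual.isCompact_closedBall (𝕜 := ℂ) (E := StrongDual ℂ B) 0
    1).tendsto_nhds_of_unique_mapClusterPt (Eventually.of_forall fun t => ?_) fun y _ hy => ?_
  · have : ‖Bidual.ι (f t)‖ ≤ 1 := (Bidual.norm_ι_le _).trans (hf.1 t).2
    simpa using this
  obtain ⟨U, hU, hUy⟩ := mapClusterPt_iff_ultrafilter.1 hy
  set m : Bidual B := WeakDual.toStrongDual y with hm
  have hlim : ∀ φ : StrongDual ℂ B, Tendsto (fun t => φ (f t)) U (𝓝 (m φ)) := fun φ =>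
    ((WeakBilin.eval_continuous _ φ).tendsto y).comp hUy
  have hmem : m ∈ Bidual.weakStarClosure (D : Set B) :=
    show y ∈ closure ((fun b => StrongDual.toWeakDual (Bidual.ι b)) '' (D : Set B)) from
      mem_closure_of_tendsto hUy (Eventually.of_forall fun t => ⟨f t, (hf.1 t).1, rfl⟩)
  have hagree : ∀ φ : StrongDual ℂ B, ∀ a ∈ D, m (φ ∘L ContinuousLinearMap.mul ℂ B a) = φ a :=
    fun φ a ha => tendsto_nhds_unique (hlim _)
      ((φ.continuous.tendsto a).comp ((hf.2 a ha).2.mono_left hU))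
  -- A cluster point `m` is a right unit for `D`, hence for its weak* closure since `η ↦ arens η m`
  -- is weak* continuous; as `p` is also a unit there, `p = pm = m`.
  have hpm : Bidual.arens p m = p := by
    ext φ
    rw [Bidual.arens_apply]
    set g : StrongDual ℂ B :=
      m ∘L (ContinuousLinearMap.compL ℂ B B ℂ φ ∘L ContinuousLinearMap.mul ℂ B) with hg
    have hcl : IsClosed {η : WeakDual ℂ (StrongDual ℂ B) | η g = η φ} :=
      isClosed_eq (WeakBilin.eval_continuous _ g) (WeakBilin.eval_continuous _ φ)
    refine closure_minimal ?_ hcl hp.1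
    rintro _ ⟨a, ha, rfl⟩
    exact hagree φ a ha
  have hpy : p = m := hpm.symm.trans (hp.2 m hmem).1
  rw [hpy]
  rfl

variable [PartialOrder B] [StarOrderedRing B]

/-- Increments are positive, so `f t - (f t)*` is constant for `t ≥ s`; multiplied by any element of
`D` it tends to zero, so it annihilates its own adjoint. -/
theorem IsCAI.isSelfAdjoint [IsDirectedOrder Λ] [Nonempty Λ] (hf : IsCAI D f) (hmono : Monotone f)
    (s : Λ) : IsSelfAdjoint (f s) := by
  have hconst : ∀ t, s ≤ t → f t - star (f t) = f s - star (f s) := fun t hst => by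
    have h := (sub_nonneg.2 (hmono hst)).isSelfAdjoint.star_eq
    rw [star_sub] at h
    exact sub_eq_sub_iff_sub_eq_sub.2 h.symm
  have hzero : ∀ a ∈ D, (f s - star (f s)) * a = 0 := fun a ha => by
    have h1 := (hf.2 (star a) (star_mem ha)).2.star
    simp only [star_mul, star_star] at h1
    have h2 := (hf.2 a ha).1.sub h1
    rw [sub_self] at h2
    refine tendsto_nhds_unique (Tendsto.congr' ?_ tendsto_const_nhds) h2
    filter_upwards [eventually_ge_atTop s] with t ht
    rw [← sub_mul, hconst t ht]
  have hD : f s - star (f s) ∈ D := sub_mem (hf.1 s).1 (star_mem (hf.1 s).1)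
  have h := hzero _ (star_mem hD)
  rw [CStarRing.mul_star_self_eq_zero_iff, sub_eq_zero] at h
  exact h.symm

theorem exists_nonneg_norm_sub_mul_lt (hD : IsClosed (D : Set B)) {a : B} (ha : a ∈ D) {ε : ℝ}
    (hε : 0 < ε) : ∃ u ∈ D, 0 ≤ u ∧ ‖u‖ ≤ 1 ∧ ‖a - u * a‖ < ε := by
  let : NonUnitalCStarAlgebra D := NonUnitalStarSubalgebra.nonUnitalCStarAlgebra (h_closed := hD) D
  let : PartialOrder D := CStarAlgebra.spectralOrder D
  have : StarOrderedRing D := CStarAlgebra.spectralOrderedRing D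
  have hU := CStarAlgebra.increasingApproximateUnit D
  obtain ⟨u, h0, h1, h2⟩ := (hU.eventually_nonneg.and (hU.eventually_norm.and
    ((Metric.tendsto_nhds.1 (hU.tendsto_mul_right ⟨a, ha⟩)) ε hε))).exists
  refine ⟨u, u.2, ?_, h1, ?_⟩
  -- Positivity in `D` refers to its own spectral order; writing `u = v* v` carries it to `B`.
  · obtain ⟨v, rfl⟩ := CStarAlgebra.nonneg_iff_eq_star_mul_self.1 h0
    exact star_mul_self_nonneg (v : B)
  · rw [dist_comm, dist_eq_norm] at h2
    exact h2

/-- Negative parts of `f t` are controlled by one fixed `f s`: if `u ∈ D` nearly fixes `f s` and `v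
= 1 - u`, then `v (1 - f t) v ≤ v (1 - f s) v ≈ v²`, and the rest of `1 - f t` carries a factor `u`,
on which `1 - f t` tends to zero. -/
theorem IsCAI.eventually_norm_one_sub_le [IsDirectedOrder Λ] [Nonempty Λ] (hf : IsCAI D f)
    (hmono : Monotone f) (hD : IsClosed (D : Set B)) {ε : ℝ} (hε : 0 < ε) :
    ∀ᶠ t in atTop, ‖1 - (f t : Unitization ℂ B)‖ ≤ 1 + ε := by
  obtain ⟨s⟩ := ‹Nonempty Λ›
  obtain ⟨u, huD, hu0, hu1, hu⟩ := exists_nonneg_norm_sub_mul_lt hD (hf.1 s).1 (half_pos hε)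
  set v : Unitization ℂ B := 1 - (u : Unitization ℂ B) with hv
  have hu0' : (0 : Unitization ℂ B) ≤ u := Unitization.inr_nonneg_iff.2 hu0
  have hv0 : 0 ≤ v := sub_nonneg.2 ((CStarAlgebra.norm_le_one_iff_of_nonneg _ hu0').1
    (by rwa [Unitization.norm_inr]))
  have hv1 : ‖v‖ ≤ 1 := (CStarAlgebra.norm_le_one_iff_of_nonneg v hv0).2 (by simpa [hv] using hu0')
  have hsa : ∀ t, IsSelfAdjoint (f t : Unitization ℂ B) := fun t => by
    rw [IsSelfAdjoint, ← Unitization.inr_star, (hf.isSelfAdjoint hmono t).star_eq]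
  have hle1 : ∀ t, (0 : Unitization ℂ B) ≤ 1 - f t := fun t => by
    rw [sub_nonneg]
    refine (IsSelfAdjoint.le_algebraMap_norm_self (hsa t)).trans ?_
    rw [← map_one (algebraMap ℝ (Unitization ℂ B))]
    exact algebraMap_mono _ (by rw [Unitization.norm_inr]; exact (hf.1 t).2)
  have hl := ((hf.2 u huD).1.const_sub u).norm
  have hr := ((hf.2 u huD).2.const_sub u).norm
  rw [sub_self, norm_zero] at hl hr
  filter_upwards [eventually_ge_atTop s, hl.eventually (gt_mem_nhds (by positivity : 0 < ε / 4)),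
    hr.eventually (gt_mem_nhds (by positivity : 0 < ε / 4))] with t hst htl htr
  have h1 : ‖v * (1 - (f t : Unitization ℂ B)) * v‖ ≤ 1 + ε / 2 := by
    have hmono' : 1 - (f t : Unitization ℂ B) ≤ 1 - (f s : Unitization ℂ B) := by
      rw [sub_le_sub_iff_left, ← sub_nonneg, ← Unitization.inr_sub, Unitization.inr_nonneg_iff]
      exact sub_nonneg.2 (hmono hst)
    refine (CStarAlgebra.norm_le_norm_of_nonneg_of_le (hv0.isSelfAdjoint.conjugate_nonneg (hle1 t))
      (hv0.isSelfAdjoint.conjugate_le_conjugate hmono')).trans ?_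
    have heq : v * (1 - (f s : Unitization ℂ B)) * v
        = v * v - ((f s - u * f s : B) : Unitization ℂ B) * v := by
      rw [Unitization.inr_sub, Unitization.inr_mul, hv]; noncomm_ring
    rw [heq]
    refine (norm_sub_le _ _).trans (add_le_add ?_ ?_)
    · exact (norm_mul_le _ _).trans (mul_le_one₀ hv1 (norm_nonneg _) hv1)
    · refine (norm_mul_le _ _).trans ?_
      rw [Unitization.norm_inr]
      exact (mul_le_of_le_one_right (norm_nonneg _) hv1).trans hu.le
  have heq : 1 - (f t : Unitization ℂ B) = v * (1 - (f t : Unitization ℂ B)) * v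
      + ((u - u * f t : B) : Unitization ℂ B) + v * ((u - f t * u : B) : Unitization ℂ B) := by
    simp only [Unitization.inr_sub, Unitization.inr_mul, hv]; noncomm_ring
  have h2 : ‖v * ((u - f t * u : B) : Unitization ℂ B)‖ ≤ ‖u - f t * u‖ := by
    refine (norm_mul_le _ _).trans ?_
    rw [Unitization.norm_inr]
    exact mul_le_of_le_one_left (norm_nonneg _) hv1
  rw [heq]
  calc _ ≤ ‖v * (1 - (f t : Unitization ℂ B)) * v‖ + ‖((u - u * f t : B) : Unitization ℂ B)‖
        + ‖v * ((u - f t * u : B) : Unitization ℂ B)‖ := norm_add₃_le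
    _ ≤ 1 + ε := by
      rw [Unitization.norm_inr]
      linarith

theorem IsCAI.isSelfUnit [IsDirectedOrder Λ] [Nonempty Λ] (hf : IsCAI D f) (hmono : Monotone f)
    (hD : IsClosed (D : Set B)) {p : Bidual B}
    (hp : Bidual.IsSupportProjection (D : Set B) p) : IsSelfUnit f p where
  tendsto_weakStar := hf.tendstoWeakStar hp
  eventually_norm_le _ hε := hf.eventually_norm_one_sub_le hmono hD hε
  tendsto_left s := by simpa using (hf.2 _ (hf.1 s).1).1.const_sub (f s)
  tendsto_right s := by simpa using (hf.2 _ (hf.1 s).1).2.const_sub (f s)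

end Hereditary

/-! ### The main theorem. -/

theorem theorem5p3 {B : Type u} [NonUnitalCStarAlgebra B] [PartialOrder B] [StarOrderedRing B]
    (p q : Bidual B) (hp : p.IsOpenProjection) (hq : q = p.compl) :
    -- increasing contractive approximate identities of the hereditary subalgebra supported by `p`
    (∀ D : NonUnitalStarSubalgebra ℂ B, IsHereditarySubalgebra D →
      Bidual.IsSupportProjection (D : Set B) p →
      ∀ (Λ : Type v) [Preorder Λ] [IsDirectedOrder Λ] [Nonempty Λ] (f : Λ → B),
        IsCAI D f → Monotone f →
        (∀ x : B, q.corner x = 0 → Tendsto (fun t => compress (f t) x) atTop (𝓝 0)) ∧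
        (∀ x : B,
          Tendsto (fun t => ‖compress (f t) x‖) atTop
            (𝓝 (Metric.infDist x {b : B | q.corner b = 0})) ∧
          Metric.infDist x {b : B | q.corner b = 0} = ‖q.corner x‖)) ∧
    -- nets in `½𝔉_B` with increasing real parts and weak* limit `p`
    (∀ (Λ : Type w) [Preorder Λ] [IsDirectedOrder Λ] [Nonempty Λ] (e : Λ → B),
      (∀ t, MemHalfF (e t)) → (Monotone fun t => (realPart (e t) : B)) →
      Bidual.TendstoWeakStar e p →
        (∀ x : B, q.corner x = 0 → Tendsto (fun t => compress (e t) x) atTop (𝓝 0)) ∧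
        (∀ A : Submodule ℂ B, IsClosedJordanSubalgebra A → (∀ t, e t ∈ A) → ∀ x ∈ A,
          Tendsto (fun t => ‖compress (e t) x‖) atTop
            (𝓝 (Metric.infDist x {a : B | a ∈ A ∧ q.corner a = 0})) ∧
          Metric.infDist x {a : B | a ∈ A ∧ q.corner a = 0} = ‖q.corner x‖)) := by

  subst hq
  refine ⟨fun D hD hDp Λ _ _ _ f hf hmono => ?_, fun Λ _ _ _ e he hmono hlim => ?_⟩
  · have h := hf.isSelfUnit hmono hD.1 hDp
    refine ⟨fun x hx => h.tendsto_compress_of_corner_eq_zero hx, fun x => ?_⟩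
    simpa using h.infDist_eq_and_tendsto (A := ⊤) (fun _ _ _ => Submodule.mem_top)
      (Submodule.mem_top (x := x))
  · have h := isSelfUnit_of_memHalfF hp.1 he hmono hlim
    exact ⟨fun x hx => h.tendsto_compress_of_corner_eq_zero hx, fun A hA heA x hx =>
      h.infDist_eq_and_tendsto (fun t y hy => hA.compress_mem (heA t) hy) hx⟩
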